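/- Identify functions on the Boolean hypercube with their Fourier expansions: every $f:\{-1,1\}^n\to\mathbb{R}$ is uniquely $f(x)=\sum_{S\subseteq\{1,\dots,n\}}\hat f(S)\prod_{i\in S}x_i$. For $\epsilon>0$ and real $k\ge 0$, the Fourier spectrum of $f$ is $\epsilon$-concentrated on degree up to $k$ if $\sum_{|S|>k}\hat f(S)^2<\epsilon$. For $0\le\eta<1$, a function $g:\{-1,1\}^V\to[0,\infty)$ on a finite set $V$ of variables is contractive with gap $1-\eta$ if (1) $g(x)\le 1$ for all $x$; (2) $\max_x g(x)=1$; (3) whenever $g(x)<1$, then $g(x)\le\eta$. It has width $w$ if $|V|\le w$. Theorem (Main). There is an absolute constant $C>0$ such that the following holds for all integers $n,m,w\ge 0$, all $\eta\in[0,1)$ and all $\epsilon\in(0,1)$. Let $f(x)=\prod_{i=1}^m f_i(x_i)$ on $\{-1,1\}^n$, where each $x_i$ is a sub-tuple of the variables $x=(x_1,\dots,x_n)$ and each $f_i$ is a contractive function with width $w$ and gap $1-\eta$. Then the Fourier spectrum of $f$ is $\epsilon$-concentrated on degree up to $$C\,w\,\log(1/\epsilon)\,\max\{1,\log_\eta\epsilon\}\quad\text{if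 }\eta>0,\qquad\text{and}\qquad C\,w\,\log(1/\epsilon)\quad\text{if }\eta=0.$$ In particular, for $0<\epsilon\le\eta$ the bound is $C\,w\,\log(1/\epsilon)\,\log_\eta\epsilon$. -/

import Mathlib

open scoped BigOperators

/-- The Boolean hypercube `{-1, 1} ^ ι`; `ℤˣ = {-1, 1}`. -/
abbrev Cube (ι : Type) : Type := ι → ℤˣ

/-- The parity function `χ_S(x) = ∏_{i ∈ S} x_i`, real valued. -/
def chi {n : ℕ} (S : Finset (Fin n)) (x : Cube (Fin n)) : ℝ :=
  ∏ i ∈ S, ((x i : ℤ) : ℝ)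

/-- The Hadamard-Fourier coefficient `E_x [f(x) χ_S(x)]`, for uniformly distributed `x`. -/
noncomputable def cubeFourierCoeff {n : ℕ} (f : Cube (Fin n) → ℝ) (S : Finset (Fin n)) : ℝ :=
  (∑ x : Cube (Fin n), f x * chi S x) / 2 ^ n

lemma sum_chi_mul_chi {n : ℕ} (x y : Cube (Fin n)) :
    ∑ S : Finset (Fin n), chi S x * chi S y = if x = y then (2 : ℝ) ^ n else 0 := by
  have h : ∑ S : Finset (Fin n), chi S x * chi S y
      = ∏ i : Fin n, (((x i : ℤ) : ℝ) * ((y i : ℤ) : ℝ) + 1) := by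
    rw [Finset.prod_add_one]
    simp [chi, Finset.prod_mul_distrib]
  rw [h]
  split_ifs with hxy
  · subst hxy
    have : ∀ i, ((x i : ℤ) : ℝ) * ((x i : ℤ) : ℝ) + 1 = 2 := by
      intro i
      rcases Int.units_eq_one_or (x i) with h1 | h1 <;> rw [h1] <;> norm_num
    simp [this]
  · obtain ⟨i, hi⟩ := Function.ne_iff.mp hxy
    refine Finset.prod_eq_zero (Finset.mem_univ i) ?_
    rcases Int.units_eq_one_or (x i) with h1 | h1 <;>
      rcases Int.units_eq_one_or (y i) with h2 | h2 <;> simp_all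

/-- `cubeFourierCoeff f` gives the coefficients of a multilinear expansion of `f`. -/
theorem fourier_expansion {n : ℕ} (f : Cube (Fin n) → ℝ) (x : Cube (Fin n)) :
    f x = ∑ S : Finset (Fin n), cubeFourierCoeff f S * chi S x := by
  have h : ∑ S : Finset (Fin n), cubeFourierCoeff f S * chi S x
      = (∑ y : Cube (Fin n), f y * ∑ S : Finset (Fin n), chi S y * chi S x) / 2 ^ n := by
    simp only [cubeFourierCoeff, div_mul_eq_mul_div, Finset.sum_mul, ← Finset.sum_div,
      Finset.mul_sum, mul_assoc]
    rw [Finset.sum_comm]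
  rw [h]
  simp [sum_chi_mul_chi]

/-- The multilinear expansion is unique. -/
theorem fourier_unique {n : ℕ} (f : Cube (Fin n) → ℝ) (c : Finset (Fin n) → ℝ)
    (hc : ∀ x, f x = ∑ S : Finset (Fin n), c S * chi S x) : c = cubeFourierCoeff f := by
  have hcard : Fintype.card (Finset (Fin n)) = Fintype.card (Cube (Fin n)) := by
    simp [Fintype.card_finset]
  let A : Matrix (Cube (Fin n)) (Finset (Fin n)) ℝ := Matrix.of fun x S => chi S x
  let B : Matrix (Finset (Fin n)) (Cube (Fin n)) ℝ := Matrix.of fun S x => chi S x / 2 ^ n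
  have hAB : A * B = 1 := by
    ext x y
    simp only [Matrix.mul_apply, A, B, Matrix.of_apply, mul_div_assoc', ← Finset.sum_div, sum_chi_mul_chi,
      Matrix.one_apply]
    split_ifs <;> simp
  have hBA : B * A = 1 := (Matrix.mul_eq_one_comm_of_equiv (Fintype.card_eq.mp hcard.symm).some).mp hAB
  have hf : f = A.mulVec c := by
    ext x
    rw [hc x]
    simp [Matrix.mulVec, dotProduct, A, mul_comm]
  have h1 : B.mulVec f = c := by
    rw [hf, Matrix.mulVec_mulVec, hBA, Matrix.one_mulVec]
  rw [← h1]
  ext S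
  simp only [Matrix.mulVec, dotProduct, B, Matrix.of_apply, cubeFourierCoeff, Finset.sum_div]
  exact Finset.sum_congr rfl fun x _ => by ring

/-- The Fourier weight `W_{>k}[f]` above degree `k`; the threshold `k` may be any real number. -/
noncomputable def fourierWeightAbove {n : ℕ} (f : Cube (Fin n) → ℝ) (k : ℝ) : ℝ :=
  ∑ S : Finset (Fin n) with k < (S.card : ℝ), cubeFourierCoeff f S ^ 2

/-- The Fourier spectrum of `f` is `ε`-concentrated on degree up to `k`. -/
def IsConcentrated {n : ℕ} (f : Cube (Fin n) → ℝ) (ε k : ℝ) : Prop :=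
  fourierWeightAbove f k < ε

/-- A real weighted factor over the variables `x_1, …, x_n`: the set of the variables in its
domain, and a function of these variables. -/
structure Factor (n : ℕ) where
  /-- the variables of the factor -/
  scope : Finset (Fin n)
  /-- the table of the factor -/
  toFun : Cube {j : Fin n // j ∈ scope} → ℝ

namespace Factor

/-- The value of a factor on a full assignment. -/
def eval {n : ℕ} (F : Factor n) (x : Cube (Fin n)) : ℝ :=
  F.toFun fun j => x j.1

/-- A factor has (bounded) width `w` if its domain has at most `w` variables. -/
def HasWidth {n : ℕ} (F : Factor n) (w : ℕ) : Prop :=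
  F.scope.card ≤ w

/-- A factor is nonnegative and contractive with gap `1 - η`. -/
structure IsContractive {n : ℕ} (F : Factor n) (η : ℝ) : Prop where
  eta_nonneg : 0 ≤ η
  eta_lt_one : η < 1
  nonneg : ∀ x, 0 ≤ F.toFun x
  le_one : ∀ x, F.toFun x ≤ 1
  max_eq_one : IsGreatest (Set.range F.toFun) 1
  gap : ∀ x, F.toFun x < 1 → F.toFun x ≤ η

end Factor

/-! Only the range `[0, 1]` and the width matter: the tail is already below `ε` at degree `O(w log
(1/ε))`, and `max 1 _` only raises the threshold. The core is the moment bound `∑ C(|S|, d) f̂(S)² ≤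
(8w)^d`. Counting `d`-subsets `T` of `S`, and applying Parseval to the alternating sum of `f` along
`T`, bounds this moment by `∑_T Pr_z[alternating sum ≠ 0]` when `|f| ≤ 1`. For `{0, 1}`-valued
factors, a nonzero alternating sum forces `T` to split into blocks inside scopes of successive
first-falsified factors, starting from some point `flip Y z` with `Y ⊆ T` (`exists_falsifyReach`).
From a fixed point at most `(4w)^d` sets arise this way (`card_falsifyReach_le`), and `Y` costs
another `2^d`. The moment is convex in each factor, so the bound passes to `[0, 1]`-valued factors.
A Markov argument with `d = ⌈log (1/ε)⌉` finishes. -/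

/-! ### Flips and alternating sums -/

/-- The point `x` with the coordinates in `U` negated. -/
def Cube.flip {n : ℕ} (U : Finset (Fin n)) (x : Cube (Fin n)) : Cube (Fin n) :=
  fun i => if i ∈ U then -x i else x i

lemma Cube.flip_empty {n : ℕ} (x : Cube (Fin n)) : Cube.flip ∅ x = x := by
  ext i; simp [Cube.flip]

lemma Cube.flip_flip_of_disjoint {n : ℕ} {U V : Finset (Fin n)} (h : Disjoint U V)
    (x : Cube (Fin n)) : Cube.flip U (Cube.flip V x) = Cube.flip (U ∪ V) x := by
  funext i
  by_cases hU : i ∈ U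
  · have hV : i ∉ V := Finset.disjoint_left.mp h hU
    simp [Cube.flip, hU, hV]
  · by_cases hV : i ∈ V <;> simp [Cube.flip, hU, hV]

lemma Cube.flip_flip {n : ℕ} (U V : Finset (Fin n)) (x : Cube (Fin n)) :
    Cube.flip U (Cube.flip V x) = Cube.flip (symmDiff U V) x := by
  funext i
  by_cases hU : i ∈ U <;> by_cases hV : i ∈ V <;>
    simp [Cube.flip, Finset.mem_symmDiff, hU, hV]

lemma Cube.flip_involutive {n : ℕ} (U : Finset (Fin n)) :
    Function.Involutive (Cube.flip U) := by
  intro x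
  rw [Cube.flip_flip, symmDiff_self]
  exact Cube.flip_empty x

lemma Cube.flip_apply_of_notMem {n : ℕ} {U : Finset (Fin n)} {i : Fin n} (h : i ∉ U)
    (x : Cube (Fin n)) : Cube.flip U x i = x i := by
  simp [Cube.flip, h]

lemma chi_flip_singleton {n : ℕ} (a : Fin n) (S : Finset (Fin n)) (x : Cube (Fin n)) :
    chi S (Cube.flip {a} x) = if a ∈ S then -chi S x else chi S x := by
  classical
  have hne : ∀ i, i ≠ a → Cube.flip {a} x i = x i := fun i hi =>
    Cube.flip_apply_of_notMem (by simpa using hi) x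
  split_ifs with h
  · rw [chi, chi, ← Finset.mul_prod_erase S _ h, ← Finset.mul_prod_erase S _ h,
      Finset.prod_congr rfl fun i hi => by rw [hne i (Finset.ne_of_mem_erase hi)]]
    simp [Cube.flip]
  · exact Finset.prod_congr rfl fun i hi => by
      rw [hne i (by rintro rfl; exact h hi)]

/-- The alternating sum of `f` over the subcube through `z` in the directions of `T`. -/
def alternatingSum {n : ℕ} (f : Cube (Fin n) → ℝ) (T : Finset (Fin n)) (z : Cube (Fin n)) : ℝ :=
  ∑ U ∈ T.powerset, (-1) ^ U.card * f (Cube.flip U z)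

lemma alternatingSum_empty {n : ℕ} (f : Cube (Fin n) → ℝ) (z : Cube (Fin n)) :
    alternatingSum f ∅ z = f z := by
  simp [alternatingSum, Cube.flip_empty]

lemma alternatingSum_insert {n : ℕ} (f : Cube (Fin n) → ℝ) {a : Fin n} {T : Finset (Fin n)}
    (ha : a ∉ T) (z : Cube (Fin n)) :
    alternatingSum f (insert a T) z
      = alternatingSum f T z - alternatingSum f T (Cube.flip {a} z) := by
  rw [alternatingSum, Finset.sum_powerset_insert ha, sub_eq_add_neg, alternatingSum,
    alternatingSum, ← Finset.sum_neg_distrib]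
  congr 1
  refine Finset.sum_congr rfl fun U hU => ?_
  have haU : a ∉ U := fun h => ha (Finset.mem_powerset.mp hU h)
  rw [Finset.card_insert_of_notMem haU,
    Cube.flip_flip_of_disjoint (Finset.disjoint_singleton_right.mpr haU), pow_succ,
    Finset.insert_eq, Finset.union_comm]
  ring

/-- The sum along `V ∪ T` is a signed sum, over `U ⊆ V`, of the sums along `T` through `flip U z`.
-/
lemma alternatingSum_union_eq_zero {n : ℕ} (f : Cube (Fin n) → ℝ) (T V : Finset (Fin n))
    (hd : Disjoint V T) :
    ∀ z, (∀ U ⊆ V, alternatingSum f T (Cube.flip U z) = 0) → alternatingSum f (V ∪ T) z = 0 := by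
  classical
  induction V using Finset.induction_on with
  | empty =>
    intro z h
    simpa [Cube.flip_empty] using h ∅ subset_rfl
  | insert a V ha ih =>
    intro z h
    rw [Finset.disjoint_insert_left] at hd
    rw [Finset.insert_union, alternatingSum_insert f (by simp [ha, hd.1]), ih hd.2, ih hd.2, sub_zero]
    · intro U hU
      rw [Cube.flip_flip_of_disjoint (Finset.disjoint_singleton_right.mpr fun h => ha (hU h))]
      exact h _ (Finset.union_subset (hU.trans (Finset.subset_insert _ _)) (by simp))
    · exact fun U hU => h U (hU.trans (Finset.subset_insert _ _))

lemma alternatingSum_eq_zero_of_const {n : ℕ} (f : Cube (Fin n) → ℝ) {T : Finset (Fin n)}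
    (hT : T.Nonempty) (z : Cube (Fin n)) (c : ℝ) (h : ∀ U ⊆ T, f (Cube.flip U z) = c) :
    alternatingSum f T z = 0 := by
  have h1 : alternatingSum f T z = ∑ U ∈ T.powerset, (-1 : ℝ) ^ U.card * c :=
    Finset.sum_congr rfl fun U hU => by rw [h U (Finset.mem_powerset.mp hU)]
  have h2 : ∑ U ∈ T.powerset, (-1 : ℝ) ^ U.card = 0 := by
    exact_mod_cast Finset.sum_powerset_neg_one_pow_card_of_nonempty hT
  rw [h1, ← Finset.sum_mul, h2, zero_mul]

lemma sq_alternatingSum_le {n : ℕ} (f : Cube (Fin n) → ℝ) (hf : ∀ x, |f x| ≤ 1)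
    (T : Finset (Fin n)) (z : Cube (Fin n)) : alternatingSum f T z ^ 2 ≤ 4 ^ T.card := by
  have h : |alternatingSum f T z| ≤ 2 ^ T.card := by
    refine (Finset.abs_sum_le_sum_abs _ _).trans ?_
    refine (Finset.sum_le_card_nsmul _ _ 1 fun U _ => ?_).trans ?_
    · rw [abs_mul, abs_pow, abs_neg, abs_one, one_pow, one_mul]
      exact hf _
    · simp
  calc alternatingSum f T z ^ 2 = |alternatingSum f T z| ^ 2 := (sq_abs _).symm
    _ ≤ (2 ^ T.card) ^ 2 := by gcongr
    _ = 4 ^ T.card := by rw [← pow_mul, mul_comm, pow_mul]; norm_num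

/-- Differencing in direction `a` doubles the characters that contain `a` and kills the others. -/
lemma alternatingSum_eq_sum_chi {n : ℕ} (f : Cube (Fin n) → ℝ) (T : Finset (Fin n)) :
    ∀ z, alternatingSum f T z
      = ∑ S, (if T ⊆ S then 2 ^ T.card * cubeFourierCoeff f S else 0) * chi S z := by
  classical
  induction T using Finset.induction_on with
  | empty => intro z; simpa [alternatingSum_empty] using fourier_expansion f z
  | insert a T ha ih =>
    intro z
    rw [alternatingSum_insert f ha, ih, ih, ← Finset.sum_sub_distrib]
    refine Finset.sum_congr rfl fun S _ => ?_
    rw [chi_flip_singleton, Finset.card_insert_of_notMem ha]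
    by_cases h1 : a ∈ S <;> by_cases h2 : T ⊆ S <;> simp [h1, h2, Finset.insert_subset_iff]
    ring

/-! ### Binomial moments of the spectrum -/

/-- Parseval's identity. -/
lemma sum_sq_cubeFourierCoeff {n : ℕ} (f : Cube (Fin n) → ℝ) :
    ∑ S, cubeFourierCoeff f S ^ 2 = (∑ x, f x ^ 2) / 2 ^ n := by
  have h : ∑ x, f x ^ 2 = ∑ x, ∑ S, f x * (cubeFourierCoeff f S * chi S x) :=
    Finset.sum_congr rfl fun x _ => by rw [← Finset.mul_sum, ← fourier_expansion, sq]
  rw [h, Finset.sum_comm, Finset.sum_div]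
  refine Finset.sum_congr rfl fun S _ => ?_
  calc cubeFourierCoeff f S ^ 2
      = cubeFourierCoeff f S * ((∑ x, f x * chi S x) / 2 ^ n) := sq _
    _ = _ := by
      rw [mul_div_assoc', Finset.mul_sum]
      congr 1
      exact Finset.sum_congr rfl fun x _ => by ring

lemma sum_sq_cubeFourierCoeff_superset {n : ℕ} (f : Cube (Fin n) → ℝ) (T : Finset (Fin n)) :
    ∑ S, (if T ⊆ S then cubeFourierCoeff f S ^ 2 else 0)
      = (∑ z, alternatingSum f T z ^ 2) / (4 ^ T.card * 2 ^ n) := by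
  have h := sum_sq_cubeFourierCoeff (alternatingSum f T)
  rw [← fourier_unique _ _ (alternatingSum_eq_sum_chi f T)] at h
  rw [mul_comm, ← div_div, ← h, Finset.sum_div]
  refine Finset.sum_congr rfl fun S _ => ?_
  by_cases hS : T ⊆ S
  · simp only [hS, if_true]
    rw [mul_pow, ← pow_mul, mul_comm T.card, pow_mul]
    norm_num
  · simp [hS]

/-- Double counting of the pairs `T ⊆ S` with `|T| = d`. -/
lemma sum_choose_mul_sq_cubeFourierCoeff {n : ℕ} (f : Cube (Fin n) → ℝ) (d : ℕ) :
    ∑ S : Finset (Fin n), (S.card.choose d : ℝ) * cubeFourierCoeff f S ^ 2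
      = ∑ T ∈ Finset.univ.powersetCard d,
          ∑ S, (if T ⊆ S then cubeFourierCoeff f S ^ 2 else 0) := by
  rw [Finset.sum_comm]
  refine Finset.sum_congr rfl fun S _ => ?_
  rw [← Finset.sum_filter, Finset.sum_const, nsmul_eq_mul, ← Finset.card_powersetCard]
  congr 3
  ext T
  simp [Finset.mem_powersetCard, and_comm]

/-- If all nonzero alternating sums of order `d` of a bounded function are few, then so is the
`d`-th binomial moment of its Fourier spectrum. -/
lemma sum_choose_mul_sq_cubeFourierCoeff_le {n : ℕ} (f : Cube (Fin n) → ℝ) (hf : ∀ x, |f x| ≤ 1)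
    (d : ℕ) (K : ℝ)
    (hK : ∑ T ∈ (Finset.univ : Finset (Fin n)).powersetCard d,
      (((Finset.univ.filter fun z => alternatingSum f T z ≠ 0).card : ℕ) : ℝ) ≤ 2 ^ n * K) :
    ∑ S : Finset (Fin n), (S.card.choose d : ℝ) * cubeFourierCoeff f S ^ 2 ≤ K := by
  rw [sum_choose_mul_sq_cubeFourierCoeff]
  have h : ∀ T ∈ (Finset.univ : Finset (Fin n)).powersetCard d,
      ∑ S, (if T ⊆ S then cubeFourierCoeff f S ^ 2 else 0) ≤
        (((Finset.univ.filter fun z => alternatingSum f T z ≠ 0).card : ℕ) : ℝ) / 2 ^ n := by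
    intro T _
    rw [sum_sq_cubeFourierCoeff_superset, mul_comm, ← div_div, div_right_comm]
    gcongr
    rw [div_le_iff₀ (by positivity), ← nsmul_eq_mul,
      ← Finset.sum_filter_of_ne (p := fun z => alternatingSum f T z ≠ 0)]
    · exact Finset.sum_le_card_nsmul _ _ _ fun z _ => sq_alternatingSum_le f hf T z
    · intro z _ hz hz0
      exact hz (by simp [hz0])
  refine (Finset.sum_le_sum h).trans ?_
  rw [← Finset.sum_div, div_le_iff₀ (by positivity), mul_comm K]
  exact hK

/-! ### Conjunctions: encoding and counting nonzero alternating sums -/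

/-- `FalsifyReach A g x T`: the set `T` is a union of nonempty blocks, the first of which lies in
the scope `A i` of the first factor `g i` that vanishes at `x`; the others are found likewise
after some coordinates of this block are negated. -/
inductive FalsifyReach {n m : ℕ} (A : Fin m → Finset (Fin n)) (g : Fin m → Cube (Fin n) → ℝ) :
    Cube (Fin n) → Finset (Fin n) → Prop
  | nil (x : Cube (Fin n)) : FalsifyReach A g x ∅
  | step {x : Cube (Fin n)} {i : Fin m} {V U T : Finset (Fin n)} (hi : g i x = 0)
      (hlt : ∀ j < i, g j x ≠ 0) (hV : V ⊆ A i) (hne : V.Nonempty) (hU : U ⊆ V)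
      (hd : Disjoint V T) (h : FalsifyReach A g (Cube.flip U x) T) : FalsifyReach A g x (V ∪ T)

/-- On the subcube along `T`, let `i` be the first factor that is not constantly 1. It depends there
only on the block `T ∩ A i`, so this block can be set to falsify `i` whatever the remaining
coordinates are, while all earlier factors stay 1. Induction handles `T \ A i`. -/
lemma exists_falsifyReach {n m : ℕ} {A : Fin m → Finset (Fin n)} {g : Fin m → Cube (Fin n) → ℝ}
    (hA : ∀ i, DependsOn (g i) (A i : Set (Fin n))) (hg : ∀ i x, g i x = 0 ∨ g i x = 1)
    (T : Finset (Fin n)) :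
    ∀ z, alternatingSum (fun x => ∏ i, g i x) T z ≠ 0 →
      ∃ Y ⊆ T, FalsifyReach A g (Cube.flip Y z) T := by
  induction T using Finset.strongInduction with
  | H T ih =>
  intro z hz
  rcases T.eq_empty_or_nonempty with rfl | hT
  · exact ⟨∅, subset_rfl, .nil _⟩
  have hex : ∃ i, ∃ U ⊆ T, g i (Cube.flip U z) ≠ 1 := by
    by_contra! h
    exact hz (alternatingSum_eq_zero_of_const _ hT z 1 fun U hU =>
      Finset.prod_eq_one fun i _ => h i U hU)
  obtain ⟨i, ⟨U₀, hU₀, hgi⟩, hmin⟩ := WellFounded.has_min (wellFounded_lt (α := Fin m))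
    {i | ∃ U ⊆ T, g i (Cube.flip U z) ≠ 1} hex
  have hone : ∀ j < i, ∀ U ⊆ T, g j (Cube.flip U z) = 1 := by
    intro j hj U hU
    by_contra h
    exact hmin j ⟨U, hU, h⟩ hj
  have hzero : g i (Cube.flip U₀ z) = 0 := (hg i _).resolve_right hgi
  have hflip : ∀ U U' : Finset (Fin n), U ∩ A i = U' ∩ A i →
      g i (Cube.flip U z) = g i (Cube.flip U' z) := by
    intro U U' h
    refine hA i fun a ha => ?_
    have := Finset.ext_iff.mp h a
    simp only [Finset.mem_inter, Finset.mem_coe.mp ha, and_true] at this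
    simp [Cube.flip, this]
  have hne : (T ∩ A i).Nonempty := by
    by_contra h
    rw [Finset.not_nonempty_iff_eq_empty] at h
    refine hz (alternatingSum_eq_zero_of_const _ hT z 0 fun U hU =>
      Finset.prod_eq_zero (Finset.mem_univ i) ?_)
    have hempty : ∀ U ⊆ T, U ∩ A i = ∅ := fun U hU =>
      Finset.subset_empty.mp ((Finset.inter_subset_inter_right hU).trans h.subset)
    rw [hflip U U₀ (by rw [hempty U hU, hempty U₀ hU₀]), hzero]
  have hdisj : Disjoint (T ∩ A i) (T \ A i) :=
    Finset.disjoint_sdiff.mono_left Finset.inter_subset_right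
  have hunion : T ∩ A i ∪ T \ A i = T := by
    rw [Finset.union_comm, Finset.sdiff_union_inter]
  -- Some setting of the block leaves a nonzero alternating sum in the remaining directions.
  obtain ⟨P, hP, hPne⟩ : ∃ P ⊆ T ∩ A i,
      alternatingSum (fun x => ∏ i, g i x) (T \ A i) (Cube.flip P z) ≠ 0 := by
    by_contra! h
    have := alternatingSum_union_eq_zero _ _ _ hdisj z h
    rw [hunion] at this
    exact hz this
  have hss : T \ A i ⊂ T := by
    refine Finset.ssubset_iff_subset_ne.mpr ⟨Finset.sdiff_subset, fun h => ?_⟩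
    obtain ⟨a, ha⟩ := hne
    rw [Finset.mem_inter] at ha
    rw [← h] at ha
    exact (Finset.mem_sdiff.mp ha.1).2 ha.2
  obtain ⟨Y, hY, hR⟩ := ih _ hss _ hPne
  have hYT : Y ∪ U₀ ∩ A i ⊆ T :=
    Finset.union_subset (hY.trans Finset.sdiff_subset) (Finset.inter_subset_left.trans hU₀)
  -- Inside the block use the falsifying pattern `U₀`, outside it the start `Y` given by induction.
  -- Negating `symmDiff (U₀ ∩ A i) P` then replaces `U₀` by `P` on the block, which is the inductive
  -- starting point.
  refine ⟨Y ∪ U₀ ∩ A i, hYT, ?_⟩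
  have hYA : ∀ a ∈ Y, a ∉ A i := fun a ha => (Finset.mem_sdiff.mp (hY ha)).2
  have hPA : ∀ a ∈ P, a ∈ A i := fun a ha => (Finset.mem_inter.mp (hP ha)).2
  rw [← hunion]
  refine .step (i := i) (U := symmDiff (U₀ ∩ A i) P) ?_ ?_ Finset.inter_subset_right hne ?_
    hdisj ?_
  · rw [hflip _ U₀, hzero]
    ext a
    have := hYA a
    simp only [Finset.mem_inter, Finset.mem_union]
    tauto
  · intro j hj
    rw [hone j hj _ hYT]
    exact one_ne_zero
  · intro a ha
    rcases Finset.mem_symmDiff.mp ha with h | h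
    · exact Finset.inter_subset_inter_right hU₀ h.1
    · exact hP h.1
  · rw [Cube.flip_flip] at hR ⊢
    convert hR using 2
    ext a
    have h1 := hYA a
    have h2 := hPA a
    simp only [Finset.mem_symmDiff, Finset.mem_inter, Finset.mem_union]
    tauto

lemma sum_two_pow_mul_four_pow (d : ℕ) :
    ∑ j ∈ Finset.Icc 1 d, 2 ^ j * 4 ^ (d - j) + 2 ^ d = 4 ^ d := by
  induction d with
  | zero => simp
  | succ d ih =>
    rw [Finset.sum_Icc_succ_top (by omega), pow_succ 4 d, ← ih]
    have : ∑ j ∈ Finset.Icc 1 d, 2 ^ j * 4 ^ (d + 1 - j)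
        = (∑ j ∈ Finset.Icc 1 d, 2 ^ j * 4 ^ (d - j)) * 4 := by
      rw [Finset.sum_mul]
      refine Finset.sum_congr rfl fun j hj => ?_
      rw [Nat.succ_sub (Finset.mem_Icc.mp hj).2, pow_succ, mul_assoc]
    rw [this]
    simp only [Nat.sub_self, pow_zero, pow_succ]
    ring

-- The point `x` determines the first falsified factor. A first block of size `j` has at most `w ^
-- j` choices and its flip `2 ^ j`; the rest has at most `(4 * w) ^ (d - j)` by induction.
-- `sum_two_pow_mul_four_pow` sums these to at most `(4 * w) ^ d`.
open Classical in
lemma card_falsifyReach_le {n m w : ℕ} {A : Fin m → Finset (Fin n)}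
    {g : Fin m → Cube (Fin n) → ℝ} (hw : ∀ i, (A i).card ≤ w) (d : ℕ) :
    ∀ x, ((Finset.univ.powersetCard d).filter (FalsifyReach A g x)).card ≤ (4 * w) ^ d := by
  induction d using Nat.strong_induction_on with
  | _ d ih =>
  intro x
  rcases Nat.eq_zero_or_pos d with rfl | hd
  · refine (Finset.card_filter_le _ _).trans ?_
    simp
  by_cases hex : ∃ i, g i x = 0
  swap
  · rw [Finset.filter_false_of_mem]
    · simp
    · intro T hT hR
      cases hR with
      | nil => simp at hT; omega
      | step hi => exact hex ⟨_, hi⟩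
  obtain ⟨i, hi, hmin⟩ := WellFounded.has_min (wellFounded_lt (α := Fin m)) {i | g i x = 0} hex
  have hsub : (Finset.univ.powersetCard d).filter (FalsifyReach A g x) ⊆
      (Finset.Icc 1 d).biUnion fun j => ((A i).powersetCard j).biUnion fun V =>
        V.powerset.biUnion fun U => ((Finset.univ.powersetCard (d - j)).filter
          (FalsifyReach A g (Cube.flip U x))).image (V ∪ ·) := by
    intro T hT
    obtain ⟨hTd, hR⟩ := Finset.mem_filter.mp hT
    replace hTd := (Finset.mem_powersetCard.mp hTd).2
    cases hR with
    | nil => simp at hTd; omega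
    | @step _ i' V U T hi' hlt hV hne hU hdis h =>
      obtain rfl : i' = i := by
        rcases lt_trichotomy i' i with hlt' | rfl | hlt'
        · exact absurd hlt' (hmin i' hi')
        · rfl
        · exact absurd hi (hlt i hlt')
      rw [Finset.card_union_of_disjoint hdis] at hTd
      simp only [Finset.mem_biUnion, Finset.mem_image, Finset.mem_filter,
        Finset.mem_powersetCard, Finset.mem_powerset, Finset.mem_Icc]
      exact ⟨V.card, ⟨hne.card_pos, by omega⟩, V, ⟨hV, rfl⟩, U, hU, T,
        ⟨⟨Finset.subset_univ _, by omega⟩, h⟩, rfl⟩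
  refine (Finset.card_le_card hsub).trans (Finset.card_biUnion_le.trans ?_)
  have hj : ∀ j ∈ Finset.Icc 1 d,
      (((A i).powersetCard j).biUnion fun V =>
        V.powerset.biUnion fun U => ((Finset.univ.powersetCard (d - j)).filter
          (FalsifyReach A g (Cube.flip U x))).image (V ∪ ·)).card
      ≤ w ^ d * (2 ^ j * 4 ^ (d - j)) := by
    intro j hj
    rw [Finset.mem_Icc] at hj
    refine (Finset.card_biUnion_le_card_mul _ _ (2 ^ j * (4 * w) ^ (d - j)) fun V hV => ?_).trans ?_
    · rw [← (Finset.mem_powersetCard.mp hV).2, ← Finset.card_powerset]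
      refine Finset.card_biUnion_le_card_mul _ _ _ fun U _ => Finset.card_image_le.trans ?_
      rw [(Finset.mem_powersetCard.mp hV).2]
      exact ih (d - j) (by omega) _
    · rw [Finset.card_powersetCard]
      calc (A i).card.choose j * (2 ^ j * (4 * w) ^ (d - j))
          ≤ w ^ j * (2 ^ j * (4 * w) ^ (d - j)) :=
            Nat.mul_le_mul_right _ ((Nat.choose_le_pow _ _).trans (Nat.pow_le_pow_left (hw i) j))
        _ = (w ^ j * w ^ (d - j)) * (2 ^ j * 4 ^ (d - j)) := by rw [mul_pow]; ring
        _ = w ^ d * (2 ^ j * 4 ^ (d - j)) := by rw [← pow_add, Nat.add_sub_cancel' hj.2]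
  refine (Finset.sum_le_sum hj).trans ?_
  rw [← Finset.mul_sum, mul_pow, mul_comm]
  exact Nat.mul_le_mul_right _ ((Nat.le_add_right _ _).trans (sum_two_pow_mul_four_pow d).le)

open Classical in
lemma sum_card_alternatingSum_ne_zero_le {n m w : ℕ} {A : Fin m → Finset (Fin n)}
    {g : Fin m → Cube (Fin n) → ℝ} (hw : ∀ i, (A i).card ≤ w)
    (hA : ∀ i, DependsOn (g i) (A i : Set (Fin n))) (hg : ∀ i x, g i x = 0 ∨ g i x = 1) (d : ℕ) :
    ∑ T ∈ (Finset.univ : Finset (Fin n)).powersetCard d,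
      (Finset.univ.filter fun z => alternatingSum (fun x => ∏ i, g i x) T z ≠ 0).card
      ≤ 2 ^ n * (8 * w) ^ d := by
  have h1 : ∀ T ∈ (Finset.univ : Finset (Fin n)).powersetCard d,
      (Finset.univ.filter fun z => alternatingSum (fun x => ∏ i, g i x) T z ≠ 0).card
      ≤ 2 ^ d * (Finset.univ.filter fun x => FalsifyReach A g x T).card := by
    intro T hT
    have hsub : (Finset.univ.filter fun z => alternatingSum (fun x => ∏ i, g i x) T z ≠ 0) ⊆
        T.powerset.biUnion fun U =>
          (Finset.univ.filter fun x => FalsifyReach A g x T).image (Cube.flip U) := by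
      intro z hz
      obtain ⟨Y, hY, hR⟩ := exists_falsifyReach hA hg T z (Finset.mem_filter.mp hz).2
      simp only [Finset.mem_biUnion, Finset.mem_image, Finset.mem_filter, Finset.mem_powerset]
      exact ⟨Y, hY, Cube.flip Y z, ⟨Finset.mem_univ _, hR⟩, Cube.flip_involutive Y z⟩
    refine (Finset.card_le_card hsub).trans ?_
    rw [← (Finset.mem_powersetCard.mp hT).2, ← Finset.card_powerset]
    exact Finset.card_biUnion_le_card_mul _ _ _ fun U _ => Finset.card_image_le
  refine (Finset.sum_le_sum h1).trans ?_
  rw [← Finset.mul_sum]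
  have h2 : ∑ T ∈ (Finset.univ : Finset (Fin n)).powersetCard d,
      (Finset.univ.filter fun x => FalsifyReach A g x T).card ≤ 2 ^ n * (4 * w) ^ d := by
    refine (Finset.sum_card_bipartiteAbove_eq_sum_card_bipartiteBelow (s := Finset.univ)
      (FalsifyReach A g)).symm.le.trans ?_
    refine (Finset.sum_le_card_nsmul _ _ _ fun x _ => card_falsifyReach_le hw d x).trans ?_
    simp
  calc _ ≤ 2 ^ d * (2 ^ n * (4 * w) ^ d) := Nat.mul_le_mul_left _ h2
    _ = 2 ^ n * (8 * w) ^ d := by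
      rw [mul_left_comm, ← mul_pow]
      ring

/-- Binomial moments of the Fourier spectrum of a conjunction of constraints of width `w`. -/
lemma binomialMoment_le_of_zero_one {n m w : ℕ} {A : Fin m → Finset (Fin n)}
    {g : Fin m → Cube (Fin n) → ℝ} (hw : ∀ i, (A i).card ≤ w)
    (hA : ∀ i, DependsOn (g i) (A i : Set (Fin n))) (hg : ∀ i x, g i x = 0 ∨ g i x = 1) (d : ℕ) :
    ∑ S : Finset (Fin n),
      (S.card.choose d : ℝ) * cubeFourierCoeff (fun x => ∏ i, g i x) S ^ 2 ≤ (8 * w : ℝ) ^ d := by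
  refine sum_choose_mul_sq_cubeFourierCoeff_le _ (fun x => ?_) d _ ?_
  · rw [Finset.abs_prod]
    refine Finset.prod_le_one (fun _ _ => abs_nonneg _) fun i _ => ?_
    rcases hg i x with h | h <;> simp [h]
  · have h := (Nat.cast_le (α := ℝ)).mpr (sum_card_alternatingSum_ne_zero_le hw hA hg d)
    push_cast at h
    refine le_trans (le_of_eq ?_) h
    congr!

/-! ### From `{0, 1}`-valued to `[0, 1]`-valued factors -/

lemma convex_sum_mul_sq_cubeFourierCoeff {n : ℕ} {V : Type} (a : Finset (Fin n) → ℝ)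
    (ha : ∀ S, 0 ≤ a S) (M : ℝ) (r : Cube (Fin n) → V) (q : Cube (Fin n) → ℝ) :
    Convex ℝ {u : V → ℝ | ∑ S, a S * cubeFourierCoeff (fun x => u (r x) * q x) S ^ 2 ≤ M} := by
  intro u hu v hv s t hs ht hst
  simp only [Set.mem_ofPred_eq] at hu hv ⊢
  have hlin : ∀ S, cubeFourierCoeff (fun x => (s • u + t • v) (r x) * q x) S
      = s * cubeFourierCoeff (fun x => u (r x) * q x) S
        + t * cubeFourierCoeff (fun x => v (r x) * q x) S := by
    intro S
    simp only [cubeFourierCoeff, mul_div_assoc', ← add_div, Finset.mul_sum,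
      ← Finset.sum_add_distrib]
    congr 1
    refine Finset.sum_congr rfl fun x _ => ?_
    simp only [Pi.add_apply, Pi.smul_apply, smul_eq_mul]
    ring
  calc _ ≤ ∑ S, (s * (a S * cubeFourierCoeff (fun x => u (r x) * q x) S ^ 2)
        + t * (a S * cubeFourierCoeff (fun x => v (r x) * q x) S ^ 2)) := by
        refine Finset.sum_le_sum fun S _ => ?_
        rw [hlin]
        have h := even_two.convexOn_pow.2 (Set.mem_univ (cubeFourierCoeff (fun x => u (r x) * q x) S))
          (Set.mem_univ (cubeFourierCoeff (fun x => v (r x) * q x) S)) hs ht hst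
        simp only [smul_eq_mul] at h
        have := mul_le_mul_of_nonneg_left h (ha S)
        linarith
    _ = s * (∑ S, a S * cubeFourierCoeff (fun x => u (r x) * q x) S ^ 2)
        + t * ∑ S, a S * cubeFourierCoeff (fun x => v (r x) * q x) S ^ 2 := by
        rw [Finset.sum_add_distrib, Finset.mul_sum, Finset.mul_sum]
    _ ≤ s * M + t * M := by gcongr
    _ = M := by rw [← add_mul, hst, one_mul]

lemma mem_convexHull_zero_one_valued {V : Type} [Finite V] (u : V → ℝ)
    (hu : ∀ y, u y ∈ Set.Icc (0 : ℝ) 1) :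
    u ∈ convexHull ℝ {v : V → ℝ | ∀ y, v y = 0 ∨ v y = 1} := by
  have h : {v : V → ℝ | ∀ y, v y = 0 ∨ v y = 1} = Set.univ.pi fun _ => {0, 1} := by
    ext v
    simp
  rw [h, convexHull_pi]
  intro y _
  rw [convexHull_pair, segment_eq_Icc zero_le_one]
  exact hu y

/-- A bound on a weighted square sum of Fourier coefficients that holds for products of
`{0, 1}`-valued factors holds for products of `[0, 1]`-valued factors with the same scopes. -/
lemma sum_mul_sq_cubeFourierCoeff_le_of_zero_one {n m : ℕ} (A : Fin m → Finset (Fin n))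
    (a : Finset (Fin n) → ℝ) (ha : ∀ S, 0 ≤ a S) (M : ℝ)
    (hM : ∀ h : ∀ i, Cube {j // j ∈ A i} → ℝ, (∀ i y, h i y = 0 ∨ h i y = 1) →
      ∑ S, a S * cubeFourierCoeff (fun x => ∏ i, h i fun j => x j.1) S ^ 2 ≤ M)
    (h : ∀ i, Cube {j // j ∈ A i} → ℝ) (hh : ∀ i y, h i y ∈ Set.Icc (0 : ℝ) 1) :
    ∑ S, a S * cubeFourierCoeff (fun x => ∏ i, h i fun j => x j.1) S ^ 2 ≤ M := by
  -- Relax one factor at a time: `s` indexes the factors already allowed to take values in `[0, 1]`.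
  suffices H : ∀ (s : Finset (Fin m)) (h : ∀ i, Cube {j // j ∈ A i} → ℝ),
      (∀ i ∈ s, ∀ y, h i y ∈ Set.Icc (0 : ℝ) 1) → (∀ i ∉ s, ∀ y, h i y = 0 ∨ h i y = 1) →
      ∑ S, a S * cubeFourierCoeff (fun x => ∏ i, h i fun j => x j.1) S ^ 2 ≤ M from
    H Finset.univ h (fun i _ => hh i) fun i hi => absurd (Finset.mem_univ i) hi
  intro s
  induction s using Finset.induction_on with
  | empty => exact fun h _ h01 => hM h fun i => h01 i (Finset.notMem_empty i)
  | insert i s hi ih =>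
    intro h hI h01
    have hprod : ∀ u : Cube {j // j ∈ A i} → ℝ,
        (fun x : Cube (Fin n) => ∏ k, Function.update h i u k fun j => x j.1)
          = fun x => (u fun j => x j.1) * ∏ k ∈ Finset.univ.erase i, h k fun j => x j.1 := by
      intro u
      funext x
      rw [← Finset.mul_prod_erase _ _ (Finset.mem_univ i), Function.update_self]
      congr 1
      exact Finset.prod_congr rfl fun k hk => by
        rw [Function.update_of_ne (Finset.ne_of_mem_erase hk)]
    have hmem := convexHull_min (𝕜 := ℝ) (fun u hu => ?_)
      (convex_sum_mul_sq_cubeFourierCoeff a ha M (fun x (j : {j // j ∈ A i}) => x j.1)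
        fun x => ∏ k ∈ Finset.univ.erase i, h k fun j => x j.1)
      (mem_convexHull_zero_one_valued (h i) (hI i (Finset.mem_insert_self i s)))
    · rw [Set.mem_ofPred_eq, ← hprod, Function.update_eq_self] at hmem
      exact hmem
    · rw [Set.mem_ofPred_eq, ← hprod]
      refine ih _ (fun k hk => ?_) fun k hk => ?_
      · rw [Function.update_of_ne (by rintro rfl; exact hi hk)]
        exact hI k (Finset.mem_insert_of_mem hk)
      · rcases eq_or_ne k i with rfl | hki
        · rw [Function.update_self]
          exact hu
        · rw [Function.update_of_ne hki]
          exact h01 k (by simp [hki, hk])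

/-- Binomial moments of the Fourier spectrum of a product of `[0, 1]`-valued factors of
width `w`. -/
lemma binomialMoment_le {n m w : ℕ} (F : Fin m → Factor n) (hw : ∀ i, (F i).HasWidth w)
    (hF : ∀ i y, (F i).toFun y ∈ Set.Icc (0 : ℝ) 1) (d : ℕ) :
    ∑ S : Finset (Fin n),
      (S.card.choose d : ℝ) * cubeFourierCoeff (fun x => ∏ i, (F i).eval x) S ^ 2
        ≤ (8 * w : ℝ) ^ d := by
  refine sum_mul_sq_cubeFourierCoeff_le_of_zero_one (fun i => (F i).scope) _
    (fun S => Nat.cast_nonneg _) _ (fun h h01 => ?_) (fun i => (F i).toFun) hF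
  refine binomialMoment_le_of_zero_one hw (g := fun i x => h i fun j => x j.1)
    (fun i x y hxy => ?_) (fun i x => h01 i _) d
  exact congrArg (h i) (funext fun j => hxy j.1 j.2)

/-! ### Tail bounds -/

/-- The weight off `∅` is the variance, at most `p - p²` for mean `p`. This covers `ε > 1/4`, where
`log (1 / ε)` may be too small to absorb rounding up. -/
lemma fourierWeightAbove_le_quarter {n : ℕ} (f : Cube (Fin n) → ℝ)
    (hf : ∀ x, f x ∈ Set.Icc (0 : ℝ) 1) {k : ℝ} (hk : 0 ≤ k) : fourierWeightAbove f k ≤ 1 / 4 := by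
  have h1 : fourierWeightAbove f k ≤ ∑ S ∈ Finset.univ.erase ∅, cubeFourierCoeff f S ^ 2 := by
    refine Finset.sum_le_sum_of_subset_of_nonneg (fun S hS => ?_) fun _ _ _ => sq_nonneg _
    refine Finset.mem_erase.mpr ⟨?_, Finset.mem_univ _⟩
    rintro rfl
    have := (Finset.mem_filter.mp hS).2
    simp at this
    linarith
  have h2 := Finset.add_sum_erase Finset.univ (fun S => cubeFourierCoeff f S ^ 2)
    (Finset.mem_univ ∅)
  have h3 : ∑ S, cubeFourierCoeff f S ^ 2 ≤ cubeFourierCoeff f ∅ := by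
    rw [sum_sq_cubeFourierCoeff, cubeFourierCoeff]
    gcongr with x
    have := hf x
    simp only [chi, Finset.prod_empty, mul_one]
    nlinarith [this.1, this.2]
  nlinarith [sq_nonneg (cubeFourierCoeff f ∅ - 1 / 2)]

lemma fourierWeightAbove_antitone {n : ℕ} (f : Cube (Fin n) → ℝ) {k k' : ℝ} (h : k ≤ k') :
    fourierWeightAbove f k' ≤ fourierWeightAbove f k := by
  refine Finset.sum_le_sum_of_subset_of_nonneg (fun S hS => ?_) fun _ _ _ => sq_nonneg _
  simp only [Finset.mem_filter, Finset.mem_univ, true_and] at hS ⊢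
  exact h.trans_lt hS

lemma div_two_mul_pow_le_choose {N d : ℕ} (hd : 0 < d) (h : 2 * d ≤ N) :
    ((N : ℝ) / (2 * d)) ^ d ≤ N.choose d := by
  refine le_trans ?_ (Nat.pow_le_choose (α := ℝ) d N)
  have hd' : (0 : ℝ) < d := by exact_mod_cast hd
  rw [← div_div, div_pow]
  have h1 : ((d.factorial : ℕ) : ℝ) ≤ (d : ℝ) ^ d := by exact_mod_cast d.factorial_le_pow
  have h2 : (N : ℝ) / 2 ≤ ((N + 1 - d : ℕ) : ℝ) := by
    rw [div_le_iff₀ two_pos]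
    exact_mod_cast (by omega : N ≤ (N + 1 - d) * 2)
  gcongr

/-- A bound on the Fourier tail from the binomial moments of the spectrum. -/
lemma fourierWeightAbove_le_of_binomialMoment {n w d : ℕ} (f : Cube (Fin n) → ℝ) (hd : 0 < d)
    (h : ∑ S : Finset (Fin n), (S.card.choose d : ℝ) * cubeFourierCoeff f S ^ 2
      ≤ (8 * w : ℝ) ^ d) (hw : 0 < w) :
    fourierWeightAbove f (64 * w * d) ≤ (1 / 4) ^ d := by
  have hd' : (0 : ℝ) < d := by exact_mod_cast hd
  have hw' : (0 : ℝ) < w := by exact_mod_cast hw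
  have hw1 : (1 : ℝ) ≤ w := by exact_mod_cast hw
  -- Markov: `|S| > 64wd` gives `C(|S|, d) ≥ (|S| / 2d)^d ≥ (32w)^d`.
  have h1 : (32 * w : ℝ) ^ d * fourierWeightAbove f (64 * w * d) ≤ (8 * w : ℝ) ^ d := by
    refine le_trans ?_ h
    rw [fourierWeightAbove, Finset.mul_sum]
    refine (Finset.sum_le_sum fun S hS => ?_).trans
      (Finset.sum_le_sum_of_subset_of_nonneg (Finset.filter_subset _ _)
        fun S _ _ => by positivity)
    have hS' := (Finset.mem_filter.mp hS).2
    have h2 : 2 * d ≤ S.card := by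
      have : (2 : ℝ) * d ≤ S.card := by nlinarith
      exact_mod_cast this
    refine mul_le_mul_of_nonneg_right (le_trans ?_ (div_two_mul_pow_le_choose hd h2))
      (sq_nonneg _)
    gcongr
    rw [le_div_iff₀ (by positivity)]
    linarith
  have h3 : (8 * w : ℝ) ^ d = (32 * w : ℝ) ^ d * (1 / 4) ^ d := by
    rw [← mul_pow]; ring
  rw [h3] at h1
  exact le_of_mul_le_mul_left h1 (by positivity)

/-- The Fourier spectrum of a product of `[0, 1]`-valued factors of width `w` is
`ε`-concentrated on degree up to `O(w log (1 / ε))`. -/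
lemma isConcentrated_of_width {n m w : ℕ} {ε : ℝ} (F : Fin m → Factor n)
    (hw : ∀ i, (F i).HasWidth w) (hF : ∀ i y, (F i).toFun y ∈ Set.Icc (0 : ℝ) 1)
    (hε : 0 < ε) (hε1 : ε < 1) :
    IsConcentrated (fun x => ∏ i, (F i).eval x) ε (128 * w * Real.log (1 / ε)) := by
  have hlog : 0 ≤ Real.log (1 / ε) := Real.log_nonneg (by rw [le_div_iff₀ hε]; linarith)
  rcases lt_or_ge (1 / 4) ε with h4 | h4
  · refine (fourierWeightAbove_le_quarter _ (fun x => ⟨?_, ?_⟩) (by positivity)).trans_lt h4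
    · exact Finset.prod_nonneg fun i _ => (hF i _).1
    · exact Finset.prod_le_one (fun i _ => (hF i _).1) fun i _ => (hF i _).2
  rcases Nat.eq_zero_or_pos w with rfl | hw0
  · have h := binomialMoment_le F hw hF 1
    refine lt_of_le_of_lt (le_trans ?_ h) (by simpa using hε)
    rw [fourierWeightAbove]
    refine (Finset.sum_le_sum fun S hS => ?_).trans
      (Finset.sum_le_sum_of_subset_of_nonneg (Finset.filter_subset _ _)
        fun S _ _ => by positivity)
    have hS' := (Finset.mem_filter.mp hS).2
    have h1 : (1 : ℝ) ≤ S.card := by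
      have : (0 : ℝ) < S.card := by simpa using hS'
      exact_mod_cast this
    rw [Nat.choose_one_right]
    exact le_mul_of_one_le_left (sq_nonneg _) h1
  -- Since `ε ≤ 1/4 < 1/e`; hence `⌈L⌉₊ ≤ 2 * L`, which turns 64 into 128.
  have hL : 1 < Real.log (1 / ε) := by
    rw [Real.lt_log_iff_exp_lt (by positivity), lt_div_iff₀ hε]
    nlinarith [Real.exp_one_lt_d9, Real.exp_pos 1]
  set L := Real.log (1 / ε) with hLdef
  have hd : 0 < ⌈L⌉₊ := Nat.ceil_pos.mpr (by linarith)
  have hdL : (⌈L⌉₊ : ℝ) ≤ 2 * L := by linarith [Nat.ceil_lt_add_one (by linarith : 0 ≤ L)]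
  have hbound := fourierWeightAbove_le_of_binomialMoment _ hd (binomialMoment_le F hw hF _) hw0
  have hthr : (64 * w * ⌈L⌉₊ : ℝ) ≤ 128 * w * L := by
    calc (64 * w * ⌈L⌉₊ : ℝ) ≤ 64 * w * (2 * L) := by gcongr
      _ = 128 * w * L := by ring
  refine ((fourierWeightAbove_antitone _ hthr).trans hbound).trans_lt ?_
  have he : (1 / 4 : ℝ) < Real.exp (-1) := by
    rw [Real.exp_neg, ← one_div]
    exact one_div_lt_one_div_of_lt (Real.exp_pos 1) (by linarith [Real.exp_one_lt_d9])
  calc (1 / 4 : ℝ) ^ ⌈L⌉₊ < Real.exp (-1) ^ ⌈L⌉₊ :=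
        pow_lt_pow_left₀ he (by norm_num) hd.ne'
    _ = Real.exp (-⌈L⌉₊) := by rw [← Real.exp_nat_mul]; ring_nf
    _ ≤ Real.exp (-L) := Real.exp_le_exp.mpr (neg_le_neg (Nat.le_ceil L))
    _ = ε := by
      rw [hLdef, one_div, Real.log_inv, neg_neg, Real.exp_log hε]

theorem theorem5 :
    ∃ C : ℝ, 0 < C ∧
      ∀ (n m w : ℕ) (η ε : ℝ) (F : Fin m → Factor n) (f : Cube (Fin n) → ℝ),
        0 ≤ η → η < 1 → 0 < ε → ε < 1 →
        (∀ i, (F i).HasWidth w) →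
        (∀ i, (F i).IsContractive η) →
        (∀ x, f x = ∏ i, (F i).eval x) →
        (0 < η →
          IsConcentrated f ε (C * w * Real.log (1 / ε) * max 1 (Real.logb η ε))) ∧
        (η = 0 → IsConcentrated f ε (C * w * Real.log (1 / ε))) := by
  refine ⟨128, by norm_num, fun n m w η ε F f _ _ hε hε1 hw hF hf => ?_⟩
  obtain rfl : f = fun x => ∏ i, (F i).eval x := funext hf
  have hmain := isConcentrated_of_width F hw
    (fun i y => ⟨(hF i).nonneg y, (hF i).le_one y⟩) hε hε1
  refine ⟨fun _ => (fourierWeightAbove_antitone _ ?_).trans_lt hmain, fun _ => hmain⟩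
  have hlog : 0 ≤ Real.log (1 / ε) := Real.log_nonneg (by rw [le_div_iff₀ hε]; linarith)
  exact le_mul_of_one_le_right (by positivity) (le_max_left _ _)
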